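/- Let $\varphi$ be Euler's totient function. For each real number $x \ge 1$ there is a greatest positive integer $m$ with $\varphi(m) \le x$; denote it by $m(x)$. Then $m(x) \sim e^{\gamma}\, x \log\log x$ as $x \to +\infty$ (through the real numbers), i.e. $\lim_{x\to+\infty} \dfrac{m(x)}{e^{\gamma} x \log\log x} = 1$, where $\gamma$ is the Euler–Mascheroni constant. -/

import Mathlib

/-- The positive integers `m` with `φ(m) ≤ x`, for a real number `x`. -/
def totientPreimage (x : ℝ) : Set ℕ :=
  {m : ℕ | 0 < m ∧ (Nat.totient m : ℝ) ≤ x}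

/-- `maxTotientPreimage x` is `m(x)`, the greatest positive integer `m` with `φ(m) ≤ x`.
(The supremum has its intended meaning only if `totientPreimage x` has a greatest element;
that it does for every `x ≥ 1` is part of the theorem.) -/
noncomputable def maxTotientPreimage (x : ℝ) : ℕ :=
  sSup (totientPreimage x)

/-! Write `w_p = -log (1 - 1/p)`, so that `m / φ(m) = exp (∑_{p ∣ m} w_p)`. Since `∑_{p ∣ m} log p ≤
log m`, the primes above `log m` contribute only `O(1 / log log m)` to the exponent. Mertens' third
theorem, `∑_{p ≤ y} w_p = log log y + γ + o(1)`, then gives `m ≤ (e^γ + o(1)) φ(m) log log m`.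
Conversely, a suitable multiple of the primorial of `(log x) / 4` has totient at most `x` and
attains this order with the same constant.

Mertens' third theorem is obtained from the first by grouping primes into blocks `⌈log p⌉ = k`. With
`b_k` the sum of `w_p` over a block, the first theorem and Dirichlet's test show that `∑ (b_k -
1/k)` converges. Abel's theorem evaluates the sum at `z = e^{-σ} → 1`: both `∑ b_k z^k` and `∑ z^k /
k` are `-log σ + o(1)`, the former by the Euler product and the pole of `ζ` at `1`. The sum is
therefore `0`, and `γ` enters through the harmonic numbers. -/

open Finset Filter Topology

/-! ### Prime weights and Mertens' first theorem -/

/-- The weight `-log (1 - 1/p)` of a prime `p`, extended by zero to the natural numbers. -/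
noncomputable def primeWeight (n : ℕ) : ℝ :=
  if n.Prime then -Real.log (1 - 1 / (n : ℝ)) else 0

lemma primeWeight_of_prime {p : ℕ} (hp : p.Prime) :
    primeWeight p = -Real.log (1 - 1 / (p : ℝ)) := if_pos hp

lemma primeWeight_of_not_prime {n : ℕ} (hn : ¬ n.Prime) : primeWeight n = 0 := if_neg hn

lemma one_sub_one_div_pos {p : ℕ} (hp : p.Prime) : (0 : ℝ) < 1 - 1 / (p : ℝ) := by
  have : (1 : ℝ) < p := by exact_mod_cast hp.one_lt
  rw [sub_pos, div_lt_one (by linarith)]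
  exact this

lemma one_div_le_primeWeight {p : ℕ} (hp : p.Prime) : 1 / (p : ℝ) ≤ primeWeight p := by
  rw [primeWeight_of_prime hp]
  have := Real.log_le_sub_one_of_pos (one_sub_one_div_pos hp)
  linarith

lemma primeWeight_le {p : ℕ} (hp : p.Prime) : primeWeight p ≤ 1 / ((p : ℝ) - 1) := by
  rw [primeWeight_of_prime hp, ← Real.log_inv]
  have h1 : (1 : ℝ) < p := by exact_mod_cast hp.one_lt
  have h := Real.log_le_sub_one_of_pos (inv_pos.2 (one_sub_one_div_pos hp))
  have e : (1 - 1 / (p : ℝ))⁻¹ - 1 = 1 / ((p : ℝ) - 1) := by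
    have : (p : ℝ) - 1 ≠ 0 := by linarith
    have : (p : ℝ) ≠ 0 := by linarith
    field_simp
    ring
  linarith

lemma primeWeight_nonneg (n : ℕ) : 0 ≤ primeWeight n := by
  by_cases hn : n.Prime
  · exact le_trans (by positivity) (one_div_le_primeWeight hn)
  · rw [primeWeight_of_not_prime hn]

/-- Legendre's formula, in logarithmic form. -/
lemma log_factorial_eq_sum (n : ℕ) :
    Real.log (n.factorial : ℝ)
      = ∑ p ∈ n.primesLE, ((n.factorial).factorization p : ℝ) * Real.log p := by
  conv_lhs => rw [← Nat.prod_factorization_pow_eq_self (Nat.factorial_ne_zero n)]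
  rw [Finsupp.prod_of_support_subset (s := n.primesLE)]
  · push_cast
    rw [Real.log_prod]
    · exact sum_congr rfl fun p _ ↦ by rw [Real.log_pow]
    · intro p hp
      have := (Nat.prime_of_mem_primesLE hp).pos
      positivity
  · intro p hp
    rw [Nat.support_factorization, Nat.mem_primeFactors] at hp
    exact Nat.mem_primesLE.2 ⟨(hp.1.dvd_factorial).1 hp.2.1, hp.1⟩
  · simp

lemma factorization_factorial_le {p : ℕ} (hp : p.Prime) (n : ℕ) :
    ((n.factorial).factorization p : ℝ) ≤ n / ((p : ℝ) - 1) := by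
  have h1 : (1 : ℝ) < p := by exact_mod_cast hp.one_lt
  have h := Nat.sub_one_mul_factorization_factorial (n := n) hp
  rw [le_div_iff₀ (by linarith)]
  have h2 : (p - 1) * (n.factorial).factorization p ≤ n := h.trans_le (Nat.sub_le _ _)
  have h3 : (((p - 1 : ℕ) : ℝ)) * ((n.factorial).factorization p : ℝ) ≤ n := by exact_mod_cast h2
  rw [Nat.cast_sub hp.one_le] at h3
  push_cast at h3
  linarith

lemma le_factorization_factorial_add_one {p : ℕ} (hp : p.Prime) (n : ℕ) :
    (n : ℝ) / p ≤ ((n.factorial).factorization p : ℝ) + 1 := by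
  have h : n / p ≤ (n.factorial).factorization p := by
    rw [Nat.factorization_factorial hp (Nat.lt_add_one (Nat.log p n))]
    by_cases hpn : p ≤ n
    · have : 1 ∈ Ico 1 (Nat.log p n + 1) :=
        mem_Ico.2 ⟨le_rfl, Nat.lt_add_of_pos_left (Nat.log_pos hp.one_lt hpn)⟩
      simpa using single_le_sum (f := fun i ↦ n / p ^ i) (fun _ _ ↦ Nat.zero_le _) this
    · rw [Nat.div_eq_of_lt (not_le.1 hpn)]; exact Nat.zero_le _
  have h2 := Nat.lt_floor_add_one ((n : ℝ) / p)
  rw [Nat.floor_div_natCast, Nat.floor_natCast] at h2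
  have h3 : ((n / p : ℕ) : ℝ) ≤ ((n.factorial).factorization p : ℝ) := by exact_mod_cast h
  linarith

/-- The series `∑ log p / (p (p - 1))` converges. -/
lemma exists_sum_log_div_le :
    ∃ C : ℝ, ∀ n : ℕ, ∑ p ∈ n.primesLE, Real.log p * (1 / ((p : ℝ) - 1) - 1 / p) ≤ C := by
  have hs : Summable fun n : ℕ ↦ 4 * (1 / (n : ℝ) ^ (3 / 2 : ℝ)) :=
    (Real.summable_one_div_nat_rpow.2 (by norm_num)).mul_left 4
  refine ⟨∑' n : ℕ, 4 * (1 / (n : ℝ) ^ (3 / 2 : ℝ)), fun n ↦ ?_⟩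
  refine le_trans (sum_le_sum (g := fun p : ℕ ↦ 4 * (1 / (p : ℝ) ^ (3 / 2 : ℝ))) fun p hp ↦ ?_)
    (hs.sum_le_tsum _ fun i _ ↦ by positivity)
  have h2 : (2 : ℝ) ≤ p := by exact_mod_cast Nat.two_le_of_mem_primesLE hp
  have hp0 : (0 : ℝ) < p := by linarith
  -- `log p ≤ 2 √p` leaves a convergent series with exponent `2 - 1/2 = 3/2`.
  have hlog : Real.log p ≤ (p : ℝ) ^ (1 / 2 : ℝ) / (1 / 2) :=
    Real.log_le_rpow_div hp0.le (by norm_num)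
  have hd : 1 / ((p : ℝ) - 1) - 1 / p ≤ 2 * (1 / (p : ℝ) ^ (2 : ℝ)) := by
    rw [Real.rpow_two]
    have : 1 / ((p : ℝ) - 1) - 1 / p = 1 / (((p : ℝ) - 1) * p) := by
      have : (p : ℝ) - 1 ≠ 0 := by linarith
      field_simp
      ring
    rw [this, mul_one_div, div_le_div_iff₀ (by nlinarith) (by positivity)]
    nlinarith
  have hd0 : 0 ≤ 1 / ((p : ℝ) - 1) - 1 / p := by
    rw [sub_nonneg]
    exact one_div_le_one_div_of_le (by linarith) (by linarith)
  calc Real.log p * (1 / ((p : ℝ) - 1) - 1 / p)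
      ≤ ((p : ℝ) ^ (1 / 2 : ℝ) / (1 / 2)) * (2 * (1 / (p : ℝ) ^ (2 : ℝ))) :=
        mul_le_mul hlog hd hd0 (by positivity)
    _ = 4 * (1 / (p : ℝ) ^ (3 / 2 : ℝ)) := by
        have : (p : ℝ) ^ (2 : ℝ) = (p : ℝ) ^ (1 / 2 : ℝ) * (p : ℝ) ^ (3 / 2 : ℝ) := by
          rw [← Real.rpow_add hp0]; norm_num
        rw [this]
        have := Real.rpow_pos_of_pos hp0 (1 / 2)
        have := Real.rpow_pos_of_pos hp0 (3 / 2)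
        field_simp
        norm_num

lemma sub_le_log_factorial (n : ℕ) (hn : 1 ≤ n) :
    (n : ℝ) * Real.log n - n ≤ Real.log (n.factorial : ℝ) := by
  have hn0 : (0 : ℝ) < n := by exact_mod_cast hn
  have hf : (0 : ℝ) < n.factorial := by exact_mod_cast n.factorial_pos
  have h := Real.pow_div_factorial_le_exp (n : ℝ) hn0.le n
  have h2 := Real.log_le_log (by positivity) h
  rw [Real.log_exp, Real.log_div (by positivity) hf.ne', Real.log_pow] at h2
  linarith

/-- **Mertens' first theorem**, with the weights `-log (1 - 1/p)`. -/
theorem exists_abs_sum_primeWeight_mul_log_sub_log_le :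
    ∃ C : ℝ, ∀ n : ℕ, 1 ≤ n →
      |∑ p ∈ n.primesLE, primeWeight p * Real.log p - Real.log n| ≤ C := by
  obtain ⟨C, hC⟩ := exists_sum_log_div_le
  refine ⟨|C| + Real.log 4 + 1, fun n hn ↦ ?_⟩
  have hn0 : (0 : ℝ) < n := by exact_mod_cast hn
  set A := ∑ p ∈ n.primesLE, primeWeight p * Real.log p
  set B := ∑ p ∈ n.primesLE, 1 / (p : ℝ) * Real.log p
  set D := ∑ p ∈ n.primesLE, 1 / ((p : ℝ) - 1) * Real.log p
  have hlog (p : ℕ) : 0 ≤ Real.log p := Real.log_natCast_nonneg p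
  -- `B ≤ A ≤ D ≤ B + C`, so a lower bound for `D` and an upper bound for `B` suffice.
  have hBA : B ≤ A := sum_le_sum fun p hp ↦ mul_le_mul_of_nonneg_right
    (one_div_le_primeWeight (Nat.prime_of_mem_primesLE hp)) (hlog p)
  have hAD : A ≤ D := sum_le_sum fun p hp ↦ mul_le_mul_of_nonneg_right
    (primeWeight_le (Nat.prime_of_mem_primesLE hp)) (hlog p)
  have hDB : D ≤ B + C := by
    have := hC n
    have e : D - B = ∑ p ∈ n.primesLE, Real.log p * (1 / ((p : ℝ) - 1) - 1 / p) := by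
      rw [← sum_sub_distrib]
      exact sum_congr rfl fun p _ ↦ by ring
    linarith
  have h1 : Real.log (n.factorial : ℝ) ≤ n * D := by
    rw [log_factorial_eq_sum, mul_sum]
    refine sum_le_sum fun p hp ↦ ?_
    rw [← mul_assoc, mul_one_div]
    exact mul_le_mul_of_nonneg_right
      (factorization_factorial_le (Nat.prime_of_mem_primesLE hp) n) (hlog p)
  -- Rounding `n / p` costs at most `1` per prime, in total `θ(n) ≤ n log 4`.
  have h2 : n * B ≤ Real.log (n.factorial : ℝ) + Real.log 4 * n := by
    refine le_trans ?_ (add_le_add_right (Chebyshev.theta_le_log4_mul_x hn0.le) _)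
    rw [log_factorial_eq_sum, Chebyshev.theta_eq_sum_primesLE_log, mul_sum, ← sum_add_distrib]
    refine sum_le_sum fun p hp ↦ ?_
    rw [← mul_assoc, mul_one_div]
    have := mul_le_mul_of_nonneg_right
      (le_factorization_factorial_add_one (Nat.prime_of_mem_primesLE hp) n) (hlog p)
    linarith
  have h3 := sub_le_log_factorial n hn
  have h4 : Real.log (n.factorial : ℝ) ≤ n * Real.log n := by
    rw [← Real.log_pow]
    refine Real.log_le_log (by exact_mod_cast n.factorial_pos) ?_
    exact_mod_cast Nat.factorial_le_pow n
  have h5 : Real.log n - 1 ≤ D := le_of_mul_le_mul_left (by linarith) hn0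
  have h6 : B ≤ Real.log n + Real.log 4 := le_of_mul_le_mul_left (by linarith) hn0
  have h7 : 0 ≤ Real.log 4 := Real.log_nonneg (by norm_num)
  have h8 := le_abs_self C
  rw [abs_le]
  constructor <;> linarith

/-! ### The Dirichlet series of the weights near `σ = 0` -/

/-- The logarithm of the Euler product of the zeta function, on the real half-line `s > 1`. -/
lemma hasSum_neg_log_one_sub_rpow {s : ℝ} (hs : 1 < s) :
    HasSum (fun n : ℕ ↦ if n.Prime then -Real.log (1 - (n : ℝ) ^ (-s)) else 0)
      (Real.log (∑' n : ℕ, 1 / (n : ℝ) ^ s)) := by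
  have hlt {p : ℕ} (hp : p.Prime) : (p : ℝ) ^ (-s) < 1 :=
    Real.rpow_lt_one_of_one_lt_of_neg (by exact_mod_cast hp.one_lt) (by linarith)
  have hpos (p : ℕ) : 0 ≤ (p : ℝ) ^ (-s) := Real.rpow_nonneg p.cast_nonneg _
  let f : ℕ →*₀ ℝ :=
    { toFun := fun n ↦ (n : ℝ) ^ (-s)
      map_zero' := by simp [Real.zero_rpow (by linarith : -s ≠ 0)]
      map_one' := by simp
      map_mul' := fun m n ↦ by simp [Real.mul_rpow] }
  have hf (n : ℕ) : f n = 1 / (n : ℝ) ^ s := by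
    change (n : ℝ) ^ (-s) = _
    rw [Real.rpow_neg n.cast_nonneg, one_div]
  have hsum' : Summable f := 
    (Real.summable_one_div_nat_rpow.2 hs).congr fun n ↦ (hf n).symm
  have hsum : Summable (‖f ·‖) := hsum'.norm
  have h := EulerProduct.eulerProduct_completely_multiplicative hsum
  have hz : 0 < ∑' n, f n := by
    refine hsum'.tsum_pos (fun n ↦ hpos n) 1 ?_
    rw [map_one]; exact one_pos
  rw [← tsum_congr hf]
  rw [hasSum_iff_tendsto_nat_of_nonneg]
  · refine ((Real.continuousAt_log hz.ne').tendsto.comp h).congr fun n ↦ ?_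
    rw [Function.comp_apply, Real.log_prod, ← sum_filter]
    · exact sum_congr rfl fun p _ ↦ by rw [Real.log_inv]; rfl
    · intro p hp
      exact inv_ne_zero (sub_pos.2 (hlt (Nat.prime_of_mem_primesBelow hp))).ne'
  · intro p
    split_ifs with hp
    · rw [neg_nonneg]
      exact Real.log_nonpos (sub_pos.2 (hlt hp)).le (by linarith [hpos p])
    · rfl

lemma neg_log_one_sub_bounds {t : ℝ} (ht : t ≤ 1 / 2) :
    t ≤ -Real.log (1 - t) ∧ -Real.log (1 - t) ≤ t + 2 * t ^ 2 := by
  constructor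
  · have := Real.log_le_sub_one_of_pos (by linarith : (0 : ℝ) < 1 - t)
    linarith
  · rw [← Real.log_inv]
    have h := Real.log_le_sub_one_of_pos (inv_pos.2 (by linarith : (0 : ℝ) < 1 - t))
    have h2 : (1 - t)⁻¹ ≤ 1 + t + 2 * t ^ 2 := by
      rw [inv_le_iff_one_le_mul₀ (by linarith)]
      nlinarith [mul_nonneg (sq_nonneg t) (by linarith : (0 : ℝ) ≤ 1 - 2 * t)]
    linarith

/-- The difference between the general terms of `log ζ(1 + σ)` and `∑ w_p p ^ (-σ)`. -/
noncomputable def eulerFactorError (σ : ℝ) (n : ℕ) : ℝ :=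
  (if n.Prime then -Real.log (1 - (n : ℝ) ^ (-(1 + σ))) else 0) - primeWeight n * (n : ℝ) ^ (-σ)

/-- With `a = 1/p` and `b = p ^ (-σ) ≤ 1`, both terms lie between `a * b` and `a * b + 2 * a ^ 2`.
Uniformity in `σ` allows dominated convergence. -/
lemma abs_eulerFactorError_le {σ : ℝ} (hσ : 0 ≤ σ) (n : ℕ) :
    |eulerFactorError σ n| ≤ 2 * (1 / (n : ℝ) ^ 2) := by
  unfold eulerFactorError
  by_cases hp : n.Prime
  · have h2 : (2 : ℝ) ≤ n := by exact_mod_cast hp.two_le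
    have hn0 : (0 : ℝ) < n := by linarith
    rw [if_pos hp, primeWeight_of_prime hp]
    set a : ℝ := 1 / (n : ℝ)
    set b : ℝ := (n : ℝ) ^ (-σ)
    have hab : (n : ℝ) ^ (-(1 + σ)) = a * b := by
      rw [neg_add, Real.rpow_add hn0, Real.rpow_neg_one, ← one_div]
    have ha0 : 0 ≤ a := by positivity
    have ha : a ≤ 1 / 2 := one_div_le_one_div_of_le two_pos h2
    have hb0 : 0 ≤ b := by positivity
    have hb : b ≤ 1 := Real.rpow_le_one_of_one_le_of_nonpos (by linarith) (by linarith)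
    have hab1 : a * b ≤ a := mul_le_of_le_one_right ha0 hb
    have hab0 : 0 ≤ a * b := by positivity
    obtain ⟨h3, h4⟩ := neg_log_one_sub_bounds ha
    obtain ⟨h5, h6⟩ := neg_log_one_sub_bounds (hab1.trans ha)
    have h7 := mul_le_mul_of_nonneg_right h3 hb0
    have h8 := mul_le_mul_of_nonneg_right h4 hb0
    have h9 : (a * b) ^ 2 ≤ a ^ 2 := by gcongr
    have h10 : a ^ 2 * b ≤ a ^ 2 := mul_le_of_le_one_right (sq_nonneg a) hb
    have e : 1 / (n : ℝ) ^ 2 = a ^ 2 := by simp [a]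
    rw [hab, e, abs_le]
    constructor <;> nlinarith
  · rw [if_neg hp, primeWeight_of_not_prime hp]
    simp

lemma summable_eulerFactorError {σ : ℝ} (hσ : 0 ≤ σ) : Summable (eulerFactorError σ) :=
  Summable.of_norm_bounded ((Real.summable_one_div_nat_pow.2 one_lt_two).mul_left 2)
    (abs_eulerFactorError_le hσ)

lemma tendsto_tsum_eulerFactorError :
    Tendsto (fun σ ↦ ∑' n, eulerFactorError σ n) (𝓝[>] 0) (𝓝 0) := by
  have h := tendsto_tsum_of_dominated_convergence (𝓕 := 𝓝[>] (0 : ℝ)) (f := eulerFactorError)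
    (g := fun _ ↦ (0 : ℝ)) (bound := fun n : ℕ ↦ 2 * (1 / (n : ℝ) ^ 2))
    ((Real.summable_one_div_nat_pow.2 one_lt_two).mul_left 2) ?_ ?_
  · simpa using h
  · intro n
    by_cases hp : n.Prime
    · have hn0 : (n : ℝ) ≠ 0 := by exact_mod_cast hp.ne_zero
      have h1 : ContinuousAt (fun σ : ℝ ↦ eulerFactorError σ n) 0 := by
        unfold eulerFactorError
        simp only [if_pos hp]
        have hne : 1 - (n : ℝ) ^ (-(1 + (0 : ℝ))) ≠ 0 := by
          have := one_sub_one_div_pos hp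
          rw [add_zero, Real.rpow_neg_one, ← one_div]
          exact this.ne'
        refine ContinuousAt.sub (ContinuousAt.neg (ContinuousAt.log ?_ hne)) ?_
        · exact continuousAt_const.sub (ContinuousAt.rpow continuousAt_const (by fun_prop) (.inl hn0))
        · exact continuousAt_const.mul (ContinuousAt.rpow continuousAt_const (by fun_prop) (.inl hn0))
      have h2 : eulerFactorError 0 n = 0 := by
        unfold eulerFactorError
        rw [if_pos hp, primeWeight_of_prime hp, add_zero, Real.rpow_neg_one]
        simp
      have := h1.tendsto
      rw [h2] at this
      exact this.mono_left nhdsWithin_le_nhds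
    · have : (fun σ : ℝ ↦ eulerFactorError σ n) = fun _ ↦ 0 := by
        funext σ
        simp [eulerFactorError, hp, primeWeight_of_not_prime hp]
      rw [this]
      exact tendsto_const_nhds
  · filter_upwards [self_mem_nhdsWithin] with σ hσ n
    exact abs_eulerFactorError_le (le_of_lt hσ) n

lemma summable_primeWeight_mul_rpow {σ : ℝ} (hσ : 0 < σ) :
    Summable fun n : ℕ ↦ primeWeight n * (n : ℝ) ^ (-σ) := by
  have h := (hasSum_neg_log_one_sub_rpow (by linarith : 1 < 1 + σ)).summable.sub
    (summable_eulerFactorError hσ.le)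
  exact h.congr fun n ↦ by simp [eulerFactorError]

/-- The logarithm of `σ ζ(1 + σ) → 1`. -/
lemma tendsto_log_zeta_add_log :
    Tendsto (fun σ : ℝ ↦ Real.log (∑' n : ℕ, 1 / (n : ℝ) ^ (1 + σ)) + Real.log σ)
      (𝓝[>] 0) (𝓝 0) := by
  have h1 : Tendsto (fun σ : ℝ ↦ 1 + σ) (𝓝[>] 0) (𝓝[>] 1) := by
    refine tendsto_nhdsWithin_iff.2 ⟨?_, ?_⟩
    · have : Tendsto (fun σ : ℝ ↦ 1 + σ) (𝓝 0) (𝓝 (1 + 0)) := by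
        apply Continuous.tendsto; fun_prop
      rw [add_zero] at this
      exact this.mono_left nhdsWithin_le_nhds
    · filter_upwards [self_mem_nhdsWithin] with σ hσ
      simpa using hσ
  have h2 := (tendsto_sub_mul_tsum_nat_rpow.comp h1)
  have h3 := (Real.continuousAt_log one_ne_zero).tendsto.comp h2
  rw [Real.log_one] at h3
  refine h3.congr' ?_
  filter_upwards [self_mem_nhdsWithin] with σ hσ
  have hσ : 0 < σ := hσ
  have hz : 0 < ∑' n : ℕ, 1 / (n : ℝ) ^ (1 + σ) :=
    (Real.summable_one_div_nat_rpow.2 (by linarith)).tsum_pos (fun n ↦ by positivity) 1 (by simp)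
  simp only [Function.comp_apply, add_sub_cancel_left]
  rw [Real.log_mul hσ.ne' hz.ne', add_comm]

/-- The Dirichlet series `∑ w_p p ^ (-σ)` equals `-log σ + o(1)` as `σ → 0+`. -/
lemma tendsto_tsum_primeWeight_mul_rpow_add_log :
    Tendsto (fun σ : ℝ ↦ ∑' n : ℕ, primeWeight n * (n : ℝ) ^ (-σ) + Real.log σ)
      (𝓝[>] 0) (𝓝 0) := by
  have h := tendsto_log_zeta_add_log.sub tendsto_tsum_eulerFactorError
  rw [sub_zero] at h
  refine h.congr' ?_
  filter_upwards [self_mem_nhdsWithin] with σ hσ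
  have hσ : 0 < σ := hσ
  have h1 := hasSum_neg_log_one_sub_rpow (by linarith : 1 < 1 + σ)
  have h2 := (summable_eulerFactorError hσ.le).hasSum
  have h3 := (h1.sub h2).tsum_eq
  have h4 : ∑' n : ℕ, primeWeight n * (n : ℝ) ^ (-σ)
      = Real.log (∑' n : ℕ, 1 / (n : ℝ) ^ (1 + σ)) - ∑' n, eulerFactorError σ n := by
    rw [← h3]
    exact tsum_congr fun n ↦ by simp [eulerFactorError]
  rw [h4]
  ring

/-! ### Logarithmic blocks -/

/-- Ensures that the blocks `0, …, K` together are exactly the integers up to `e^K`. As `Real.log 0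
= 0`, the integer `0` falls in block `0`. -/
lemma ceil_log_le_iff (n k : ℕ) : ⌈Real.log n⌉₊ ≤ k ↔ n ≤ ⌊Real.exp k⌋₊ := by
  rw [Nat.ceil_le, Nat.le_floor_iff (Real.exp_nonneg _)]
  rcases Nat.eq_zero_or_pos n with rfl | hn
  · simp [Real.exp_nonneg]
  · exact Real.log_le_iff_le_exp (by exact_mod_cast hn)

/-- The sum of `f n` over the integers `n` with `⌈log n⌉ = k`. -/
noncomputable def logBlockSum (f : ℕ → ℝ) (k : ℕ) : ℝ :=
  ∑ n ∈ (range (⌊Real.exp k⌋₊ + 1)).filter fun n : ℕ ↦ ⌈Real.log n⌉₊ = k, f n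

lemma sum_logBlockSum (f : ℕ → ℝ) (K : ℕ) :
    ∑ k ∈ range (K + 1), logBlockSum f k = ∑ n ∈ range (⌊Real.exp K⌋₊ + 1), f n := by
  have h : ∀ k ∈ range (K + 1), logBlockSum f k
      = ∑ n ∈ (range (⌊Real.exp K⌋₊ + 1)).filter fun n : ℕ ↦ ⌈Real.log n⌉₊ = k, f n := by
    intro k hk
    unfold logBlockSum
    congr 1
    ext n
    simp only [mem_filter, mem_range, Nat.lt_succ_iff, ← ceil_log_le_iff] at hk ⊢
    omega
  rw [sum_congr rfl h]
  refine sum_fiberwise_of_maps_to (fun n hn ↦ ?_) f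
  simp only [mem_range, Nat.lt_succ_iff, ← ceil_log_le_iff] at hn ⊢
  exact hn

lemma logBlockSum_zero {f : ℕ → ℝ} (h0 : f 0 = 0) (h1 : f 1 = 0) : logBlockSum f 0 = 0 := by
  have := sum_logBlockSum f 0
  simpa [sum_range_succ, h0, h1] using this

lemma tendsto_floor_exp_atTop : Tendsto (fun k : ℕ ↦ ⌊Real.exp k⌋₊) atTop atTop :=
  tendsto_nat_floor_atTop.comp (Real.tendsto_exp_atTop.comp tendsto_natCast_atTop_atTop)

lemma logBlockSum_mono {f g : ℕ → ℝ} {k : ℕ}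
    (h : ∀ n : ℕ, ⌈Real.log (n : ℝ)⌉₊ = k → f n ≤ g n) : logBlockSum f k ≤ logBlockSum g k :=
  sum_le_sum fun n hn ↦ h n (mem_filter.1 hn).2

lemma logBlockSum_nonneg {f : ℕ → ℝ} (h : ∀ n, 0 ≤ f n) (k : ℕ) : 0 ≤ logBlockSum f k :=
  sum_nonneg fun n _ ↦ h n

lemma logBlockSum_mul_const (f : ℕ → ℝ) (c : ℝ) (k : ℕ) :
    logBlockSum (fun n ↦ f n * c) k = logBlockSum f k * c :=
  (sum_mul _ _ _).symm

lemma HasSum.logBlockSum {f : ℕ → ℝ} {a : ℝ} (hf : ∀ n, 0 ≤ f n) (h : HasSum f a) :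
    HasSum (logBlockSum f) a := by
  rw [hasSum_iff_tendsto_nat_of_nonneg (logBlockSum_nonneg hf), ← tendsto_add_atTop_iff_nat 1]
  have h2 := h.tendsto_sum_nat.comp
    ((tendsto_add_atTop_nat 1).comp tendsto_floor_exp_atTop)
  exact h2.congr fun K ↦ (sum_logBlockSum f K).symm

lemma primeWeight_zero : primeWeight 0 = 0 := primeWeight_of_not_prime Nat.not_prime_zero

lemma primeWeight_one : primeWeight 1 = 0 := primeWeight_of_not_prime Nat.not_prime_one

lemma sum_range_eq_sum_primesLE (g : ℕ → ℝ) (hg : ∀ n, ¬ n.Prime → g n = 0) (n : ℕ) :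
    ∑ m ∈ range (n + 1), g m = ∑ p ∈ n.primesLE, g p := by
  refine (sum_subset (fun p hp ↦ ?_) fun m hm hm' ↦ ?_).symm
  · simpa [Nat.lt_succ_iff] using Nat.le_of_mem_primesLE hp
  · exact hg m fun h ↦ hm' (Nat.mem_primesLE.2 ⟨Nat.lt_succ_iff.1 (mem_range.1 hm), h⟩)

lemma abs_log_floor_exp_sub_le (K : ℕ) : |Real.log (⌊Real.exp K⌋₊ : ℝ) - K| ≤ Real.log 2 := by
  have h1 : (1 : ℝ) ≤ Real.exp K := Real.one_le_exp K.cast_nonneg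
  have h1' : 1 ≤ ⌊Real.exp K⌋₊ := Nat.le_floor (by simp)
  have h1'' : (1 : ℝ) ≤ ⌊Real.exp K⌋₊ := by exact_mod_cast h1'
  have h2 : (⌊Real.exp K⌋₊ : ℝ) ≤ Real.exp K := Nat.floor_le (Real.exp_nonneg _)
  have h3 := Nat.lt_floor_add_one (Real.exp K)
  have h4 := Real.log_le_log (by linarith) h2
  have h5 := Real.log_le_log (by linarith) (by linarith : Real.exp K ≤ 2 * ⌊Real.exp K⌋₊)
  rw [Real.log_mul two_ne_zero (by linarith)] at h5
  rw [Real.log_exp] at h4 h5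
  have := Real.log_nonneg one_le_two
  rw [abs_le]
  constructor <;> linarith

/-- Partial sums of the excess of `∑ w_p log p` over each logarithmic block are bounded. -/
lemma exists_abs_sum_logBlockSum_sub_one_le :
    ∃ C : ℝ, ∀ K : ℕ, ‖∑ k ∈ range K,
      (logBlockSum (fun n ↦ primeWeight n * Real.log n) (k + 1) - 1)‖ ≤ C := by
  obtain ⟨C, hC⟩ := exists_abs_sum_primeWeight_mul_log_sub_log_le
  refine ⟨C + Real.log 2, fun K ↦ ?_⟩
  have h1 := sum_logBlockSum (fun n ↦ primeWeight n * Real.log n) K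
  rw [sum_range_succ', logBlockSum_zero (by simp) (by simp), add_zero,
    sum_range_eq_sum_primesLE _ (fun n hn ↦ by simp [primeWeight_of_not_prime hn])] at h1
  rw [sum_sub_distrib, h1]
  have h2 := hC ⌊Real.exp K⌋₊ (Nat.le_floor (by simp))
  have h3 := abs_log_floor_exp_sub_le K
  simp only [sum_const, card_range, nsmul_eq_mul, mul_one, Real.norm_eq_abs]
  rw [abs_le] at *
  constructor <;> linarith

lemma half_ceil_log_le {n : ℕ} (hn : 2 ≤ n) : (⌈Real.log n⌉₊ : ℝ) / 2 ≤ Real.log n := by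
  have h2 : (2 : ℝ) ≤ n := by exact_mod_cast hn
  have h := Real.log_le_log two_pos h2
  have h3 := Real.log_two_gt_d9
  have h4 := Nat.ceil_lt_add_one (by linarith : 0 ≤ Real.log n)
  rcases le_or_gt 1 (Real.log n) with h5 | h5
  · linarith
  · have : ⌈Real.log n⌉₊ ≤ 1 := Nat.ceil_le.2 (by simpa using h5.le)
    have : (⌈Real.log n⌉₊ : ℝ) ≤ 1 := by exact_mod_cast this
    linarith

/-- A prime in block `k + 1` has `k < log p ≤ k + 1`, so replacing `1 / log p` by `1 / (k + 1)`
costs `O(1 / (k + 1)^2)`, which is summable. -/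
lemma logBlockSum_primeWeight_bounds (k : ℕ) :
    logBlockSum (fun n ↦ primeWeight n * Real.log n) (k + 1) / ((k : ℝ) + 1)
        ≤ logBlockSum primeWeight (k + 1) ∧
      logBlockSum primeWeight (k + 1) ≤
        logBlockSum (fun n ↦ primeWeight n * Real.log n) (k + 1) / ((k : ℝ) + 1)
        + 2 * logBlockSum (fun n ↦ primeWeight n * Real.log n) (k + 1) / ((k : ℝ) + 1) ^ 2 := by
  have hk : (0 : ℝ) < (k : ℝ) + 1 := by positivity
  have key {n : ℕ} (hn : ⌈Real.log (n : ℝ)⌉₊ = k + 1) (hp : n.Prime) :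
      Real.log n ≤ k + 1 ∧ (k : ℝ) < Real.log n ∧ ((k : ℝ) + 1) / 2 ≤ Real.log n := by
    have h1 := Nat.le_ceil (Real.log n)
    have h2 := Nat.ceil_lt_add_one (Real.log_natCast_nonneg n)
    have h3 := half_ceil_log_le hp.two_le
    rw [hn] at h1 h2 h3
    push_cast at h1 h2 h3
    exact ⟨h1, by linarith, h3⟩
  constructor
  · rw [div_eq_mul_inv, ← logBlockSum_mul_const]
    refine logBlockSum_mono fun n hn ↦ ?_
    by_cases hp : n.Prime
    · rw [mul_assoc]
      refine mul_le_of_le_one_right (primeWeight_nonneg n) ?_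
      rw [← div_eq_mul_inv, div_le_one hk]
      exact (key hn hp).1
    · simp [primeWeight_of_not_prime hp]
  · have e (X : ℝ) : X / ((k : ℝ) + 1) + 2 * X / ((k : ℝ) + 1) ^ 2
        = X * (1 / ((k : ℝ) + 1) + 2 / ((k : ℝ) + 1) ^ 2) := by ring
    rw [e, ← logBlockSum_mul_const]
    refine logBlockSum_mono fun n hn ↦ ?_
    by_cases hp : n.Prime
    · rw [mul_assoc]
      refine le_mul_of_one_le_right (primeWeight_nonneg n) ?_
      obtain ⟨-, h2, h3⟩ := key hn hp
      have e2 : 1 / ((k : ℝ) + 1) + 2 / ((k : ℝ) + 1) ^ 2 = ((k : ℝ) + 3) / ((k : ℝ) + 1) ^ 2 := by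
        field_simp; ring
      rw [e2, ← mul_div_assoc, one_le_div (by positivity)]
      -- For `k ≥ 1`, `k (k + 3) ≥ (k + 1)^2`; for `k = 0`, `log p > k` is too weak and `log p ≥
      -- 1/2` is used.
      rcases Nat.eq_zero_or_pos k with rfl | hk1
      · push_cast at *; nlinarith
      · have : (1 : ℝ) ≤ k := by exact_mod_cast hk1
        nlinarith
    · simp [primeWeight_of_not_prime hp]

/-- The sums of the weights over the logarithmic blocks compare to the harmonic series. -/
lemma exists_tendsto_sum_logBlockSum_sub_inv :
    ∃ L : ℝ, Tendsto (fun K ↦ ∑ k ∈ range K, (logBlockSum primeWeight k - 1 / (k : ℝ)))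
      atTop (𝓝 L) := by
  obtain ⟨C, hC⟩ := exists_abs_sum_logBlockSum_sub_one_le
  set a : ℕ → ℝ := fun k ↦ logBlockSum (fun n ↦ primeWeight n * Real.log n) (k + 1)
  have ha0 (k : ℕ) : 0 ≤ a k := logBlockSum_nonneg
    (fun n ↦ mul_nonneg (primeWeight_nonneg n) (Real.log_natCast_nonneg n)) _
  have haC (k : ℕ) : a k ≤ 2 * C + 1 := by
    have h1 := hC k
    have h2 := hC (k + 1)
    rw [sum_range_succ] at h2
    rw [Real.norm_eq_abs, abs_le] at h1 h2
    linarith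
  have hanti : Antitone fun k : ℕ ↦ 1 / ((k : ℝ) + 1) := fun m n hmn ↦
    one_div_le_one_div_of_le (by positivity) (by gcongr)
  -- Dirichlet's test: `∑ (a k - 1) / (k + 1)` converges, having bounded partial sums against a
  -- weight decreasing to `0`.
  obtain ⟨L₁, hL₁⟩ := cauchySeq_tendsto_of_complete
    (hanti.cauchySeq_series_mul_of_tendsto_zero_of_bounded tendsto_one_div_add_atTop_nhds_zero_nat hC)
  have hsq : Summable fun k : ℕ ↦ 2 * (2 * C + 1) * (1 / ((k : ℝ) + 1) ^ 2) := by
    have := (summable_nat_add_iff 1).2 (Real.summable_one_div_nat_pow.2 one_lt_two)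
    push_cast at this
    exact this.mul_left _
  have hsum : Summable fun k : ℕ ↦ logBlockSum primeWeight (k + 1) - a k / ((k : ℝ) + 1) := by
    refine Summable.of_nonneg_of_le (fun k ↦ ?_) (fun k ↦ ?_) hsq
    · exact sub_nonneg.2 (logBlockSum_primeWeight_bounds k).1
    · have h1 := (logBlockSum_primeWeight_bounds k).2
      have h2 : 2 * a k / ((k : ℝ) + 1) ^ 2 ≤ 2 * (2 * C + 1) * (1 / ((k : ℝ) + 1) ^ 2) := by
        rw [mul_one_div]
        have := haC k
        gcongr
      linarith
  refine ⟨_, (tendsto_add_atTop_iff_nat 1).1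
    ((hL₁.add hsum.hasSum.tendsto_sum_nat).congr fun K ↦ ?_)⟩
  rw [sum_range_succ', logBlockSum_zero primeWeight_zero primeWeight_one, ← sum_add_distrib]
  simp only [Nat.cast_zero, div_zero, sub_zero, add_zero]
  refine sum_congr rfl fun k _ ↦ ?_
  rw [smul_eq_mul]
  push_cast
  ring

/-! ### Abel summation and the value of the limit -/

lemma exp_neg_mul_ceil_log_bounds {σ : ℝ} (hσ : 0 < σ) {n : ℕ} (hn : 1 ≤ n) :
    Real.exp (-σ) * (n : ℝ) ^ (-σ) ≤ Real.exp (-σ) ^ ⌈Real.log (n : ℝ)⌉₊ ∧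
      Real.exp (-σ) ^ ⌈Real.log (n : ℝ)⌉₊ ≤ (n : ℝ) ^ (-σ) := by
  have hn0 : (0 : ℝ) < n := by exact_mod_cast hn
  have h1 := Nat.le_ceil (Real.log n)
  have h2 := Nat.ceil_lt_add_one (Real.log_natCast_nonneg n)
  rw [Real.rpow_def_of_pos hn0, ← Real.exp_add, ← Real.exp_nat_mul]
  constructor <;> apply Real.exp_le_exp.2 <;> nlinarith

/-- Rounding `log n` up to an integer changes `n ^ (-σ)` by a factor in `[e^{-σ}, 1]`, so the power
series of the blocks at `e^{-σ}` is comparable to the Dirichlet series. -/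
lemma exists_hasSum_logBlockSum_mul_pow {σ : ℝ} (hσ : 0 < σ) :
    ∃ G : ℝ, HasSum (fun k ↦ logBlockSum primeWeight k * Real.exp (-σ) ^ k) G ∧
      Real.exp (-σ) * ∑' n : ℕ, primeWeight n * (n : ℝ) ^ (-σ) ≤ G ∧
      G ≤ ∑' n : ℕ, primeWeight n * (n : ℝ) ^ (-σ) := by
  have hs := summable_primeWeight_mul_rpow hσ
  have hle (n : ℕ) : primeWeight n * Real.exp (-σ) ^ ⌈Real.log (n : ℝ)⌉₊
      ≤ primeWeight n * (n : ℝ) ^ (-σ) := by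
    rcases Nat.eq_zero_or_pos n with rfl | hn
    · simp [primeWeight_zero]
    · exact mul_le_mul_of_nonneg_left (exp_neg_mul_ceil_log_bounds hσ hn).2 (primeWeight_nonneg n)
  have hge (n : ℕ) : Real.exp (-σ) * (primeWeight n * (n : ℝ) ^ (-σ))
      ≤ primeWeight n * Real.exp (-σ) ^ ⌈Real.log (n : ℝ)⌉₊ := by
    rcases Nat.eq_zero_or_pos n with rfl | hn
    · simp [primeWeight_zero]
    · rw [mul_left_comm]
      exact mul_le_mul_of_nonneg_left (exp_neg_mul_ceil_log_bounds hσ hn).1 (primeWeight_nonneg n)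
  have h0 (n : ℕ) : 0 ≤ primeWeight n * Real.exp (-σ) ^ ⌈Real.log (n : ℝ)⌉₊ :=
    mul_nonneg (primeWeight_nonneg n) (by positivity)
  have hs' := Summable.of_nonneg_of_le h0 hle hs
  refine ⟨_, (hs'.hasSum.logBlockSum h0).congr_fun ?_, ?_, hs'.tsum_le_tsum hle hs⟩
  · intro k
    rw [← logBlockSum_mul_const]
    exact sum_congr rfl fun n hn ↦ by simp only [(mem_filter.1 hn).2]
  · rw [← tsum_mul_left]
    exact (hs.mul_left _).tsum_le_tsum hge hs'

/-- The term `k = 0` vanishes because `1 / 0 = 0`. -/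
lemma hasSum_one_div_mul_pow {z : ℝ} (hz : |z| < 1) :
    HasSum (fun k : ℕ ↦ 1 / (k : ℝ) * z ^ k) (-Real.log (1 - z)) := by
  rw [← hasSum_nat_add_iff' 1]
  simpa [div_eq_mul_inv, mul_comm] using Real.hasSum_pow_div_log_of_abs_lt_one hz

lemma tendsto_exp_neg_nhdsGT_zero :
    Tendsto (fun σ : ℝ ↦ Real.exp (-σ)) (𝓝[>] 0) (𝓝[<] 1) := by
  refine tendsto_nhdsWithin_iff.2 ⟨?_, ?_⟩
  · have : Tendsto (fun σ : ℝ ↦ Real.exp (-σ)) (𝓝 0) (𝓝 (Real.exp (-0))) := by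
      apply Continuous.tendsto; fun_prop
    rw [neg_zero, Real.exp_zero] at this
    exact this.mono_left nhdsWithin_le_nhds
  · filter_upwards [self_mem_nhdsWithin] with σ hσ
    have hσ : 0 < σ := hσ
    simpa using hσ

lemma tendsto_one_sub_exp_neg_div :
    Tendsto (fun σ : ℝ ↦ (1 - Real.exp (-σ)) / σ) (𝓝[>] 0) (𝓝 1) := by
  have h : HasDerivAt (fun σ : ℝ ↦ -Real.exp (-σ)) 1 0 := by
    have := ((hasDerivAt_neg (0 : ℝ)).exp).fun_neg
    simpa using this
  have h2 := h.tendsto_slope.mono_left (nhdsWithin_mono 0 fun x (hx : 0 < x) ↦ hx.ne')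
  refine h2.congr fun σ ↦ ?_
  simp [slope_def_field]
  ring

lemma tendsto_log_one_sub_exp_neg_sub_log :
    Tendsto (fun σ : ℝ ↦ Real.log (1 - Real.exp (-σ)) - Real.log σ) (𝓝[>] 0) (𝓝 0) := by
  have h := (Real.continuousAt_log one_ne_zero).tendsto.comp tendsto_one_sub_exp_neg_div
  rw [Real.log_one] at h
  refine h.congr' ?_
  filter_upwards [self_mem_nhdsWithin] with σ hσ
  have hσ : 0 < σ := hσ
  have : Real.exp (-σ) < 1 := by simpa using hσ
  rw [Function.comp_apply, Real.log_div (by linarith) hσ.ne']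

/-- By Abel's limit theorem, the weights over the logarithmic blocks and the harmonic series have
partial sums with vanishing difference. -/
lemma tendsto_sum_logBlockSum_sub_inv :
    Tendsto (fun K ↦ ∑ k ∈ range K, (logBlockSum primeWeight k - 1 / (k : ℝ))) atTop (𝓝 0) := by
  obtain ⟨L, hL⟩ := exists_tendsto_sum_logBlockSum_sub_inv
  have habel := (Real.tendsto_tsum_powerSeries_nhdsWithin_lt hL).comp tendsto_exp_neg_nhdsGT_zero
  set g : ℝ → ℝ := fun σ ↦ ∑' n : ℕ, primeWeight n * (n : ℝ) ^ (-σ)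
  have hg := tendsto_tsum_primeWeight_mul_rpow_add_log
  have hup : Tendsto (fun σ ↦ g σ + Real.log σ
      + (Real.log (1 - Real.exp (-σ)) - Real.log σ)) (𝓝[>] 0) (𝓝 0) := by
    simpa using hg.add tendsto_log_one_sub_exp_neg_sub_log
  -- The bounds `g σ` and `e^{-σ} g σ` differ by `(1 - e^{-σ}) g σ`, of order `σ |log σ|`.
  have hgap : Tendsto (fun σ ↦ (1 - Real.exp (-σ)) * g σ) (𝓝[>] 0) (𝓝 0) := by
    have h1 : Tendsto (fun σ : ℝ ↦ σ * (g σ + Real.log σ) - Real.log σ * σ) (𝓝[>] 0) (𝓝 0) := by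
      have h2 := tendsto_log_mul_rpow_nhdsGT_zero zero_lt_one
      simp only [Real.rpow_one] at h2
      have h3 : Tendsto (fun σ : ℝ ↦ σ) (𝓝[>] 0) (𝓝 0) := nhdsWithin_le_nhds
      simpa using (h3.mul hg).sub h2
    have h4 := tendsto_one_sub_exp_neg_div.mul h1
    rw [mul_zero] at h4
    refine h4.congr' ?_
    filter_upwards [self_mem_nhdsWithin] with σ hσ
    have hσ : σ ≠ 0 := ne_of_gt hσ
    field_simp
    ring
  have hlow := hup.sub hgap
  rw [sub_zero] at hlow
  have hF : ∀ᶠ σ : ℝ in 𝓝[>] 0, ∃ G : ℝ,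
      (∑' k : ℕ, (logBlockSum primeWeight k - 1 / (k : ℝ)) * Real.exp (-σ) ^ k)
        = G + Real.log (1 - Real.exp (-σ)) ∧ Real.exp (-σ) * g σ ≤ G ∧ G ≤ g σ := by
    filter_upwards [self_mem_nhdsWithin] with σ hσ
    have hσ : 0 < σ := hσ
    obtain ⟨G, hG, h1, h2⟩ := exists_hasSum_logBlockSum_mul_pow hσ
    have hz : |Real.exp (-σ)| < 1 := by
      rw [abs_of_pos (Real.exp_pos _)]
      simpa using hσ
    refine ⟨G, ?_, h1, h2⟩
    have h3 := (hG.sub (hasSum_one_div_mul_pow hz)).tsum_eq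
    rw [sub_neg_eq_add] at h3
    rw [← h3]
    exact tsum_congr fun k ↦ sub_mul _ _ _
  have hzero := tendsto_of_tendsto_of_tendsto_of_le_of_le' hlow hup
    (f := fun σ : ℝ ↦ ∑' k : ℕ, (logBlockSum primeWeight k - 1 / (k : ℝ)) * Real.exp (-σ) ^ k)
    (by filter_upwards [hF] with σ ⟨G, h1, h2, h3⟩; rw [h1]; linarith)
    (by filter_upwards [hF] with σ ⟨G, h1, h2, h3⟩; rw [h1]; linarith)
  rw [tendsto_nhds_unique habel hzero] at hL
  exact hL

/-! ### Mertens' third theorem -/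

lemma tendsto_sum_primeWeight_floor_exp_sub_log :
    Tendsto (fun K : ℕ ↦ ∑ p ∈ ⌊Real.exp K⌋₊.primesLE, primeWeight p - Real.log K) atTop
      (𝓝 Real.eulerMascheroniConstant) := by
  have h := ((tendsto_add_atTop_iff_nat 1).2 tendsto_sum_logBlockSum_sub_inv).add
    Real.tendsto_harmonic_sub_log
  rw [zero_add] at h
  refine h.congr fun K ↦ ?_
  rw [sum_sub_distrib, sum_logBlockSum,
    sum_range_eq_sum_primesLE _ (fun n hn ↦ primeWeight_of_not_prime hn), sum_range_succ',
    harmonic]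
  push_cast
  simp

/-- **Mertens' third theorem**, in logarithmic form. -/
theorem tendsto_sum_primeWeight_sub_log_log :
    Tendsto (fun x : ℝ ↦ ∑ p ∈ ⌊x⌋₊.primesLE, primeWeight p - Real.log (Real.log x)) atTop
      (𝓝 Real.eulerMascheroniConstant) := by
  have hK : Tendsto (fun x : ℝ ↦ ⌊Real.log x⌋₊) atTop atTop :=
    tendsto_nat_floor_atTop.comp Real.tendsto_log_atTop
  have hd : Tendsto (fun K : ℕ ↦ Real.log ((K : ℝ) + 1) - Real.log K) atTop (𝓝 0) := by
    exact_mod_cast Real.tendsto_log_nat_add_one_sub_log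
  have h0 := tendsto_sum_primeWeight_floor_exp_sub_log
  have h1 := (tendsto_add_atTop_iff_nat 1).2 h0
  have hmono {m n : ℕ} (h : m ≤ n) :
      ∑ p ∈ m.primesLE, primeWeight p ≤ ∑ p ∈ n.primesLE, primeWeight p :=
    sum_le_sum_of_subset_of_nonneg
      (fun p hp ↦ Nat.mem_primesLE.2 ⟨(Nat.le_of_mem_primesLE hp).trans h,
        Nat.prime_of_mem_primesLE hp⟩) fun p _ _ ↦ primeWeight_nonneg p
  -- With `K = ⌊log x⌋`, `e^K ≤ x < e^(K + 1)`; the two bounds agree in the limit since `log (K + 1)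
  -- - log K → 0`.
  have hlow := (h0.sub hd).comp hK
  have hup := (h1.add hd).comp hK
  rw [sub_zero] at hlow
  rw [add_zero] at hup
  refine tendsto_of_tendsto_of_tendsto_of_le_of_le' hlow hup ?_ ?_
  all_goals
    filter_upwards [eventually_ge_atTop (Real.exp 1)] with x hx
    have hx0 : 0 < x := (Real.exp_pos 1).trans_le hx
    have hl : 1 ≤ Real.log x := (Real.le_log_iff_exp_le hx0).2 hx
    have hK1 : 1 ≤ ⌊Real.log x⌋₊ := Nat.le_floor (by simpa using hl)
    have hK1' : (1 : ℝ) ≤ ⌊Real.log x⌋₊ := by exact_mod_cast hK1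
    have hf := Nat.floor_le (by linarith : 0 ≤ Real.log x)
    have hf' := Nat.lt_floor_add_one (Real.log x)
  · have h2 : ⌊Real.exp ⌊Real.log x⌋₊⌋₊ ≤ ⌊x⌋₊ :=
      Nat.floor_le_floor ((Real.le_log_iff_exp_le hx0).1 hf)
    have h3 := Real.log_le_log (by linarith) hf'.le
    have := hmono h2
    simp only [Function.comp_apply]
    linarith
  · have h2 : ⌊x⌋₊ ≤ ⌊Real.exp (⌊Real.log x⌋₊ + 1 : ℕ)⌋₊ := by
      refine Nat.floor_le_floor ((Real.log_le_iff_le_exp hx0).1 ?_)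
      push_cast
      exact hf'.le
    have h3 := Real.log_le_log (by linarith) hf
    have := hmono h2
    simp only [Function.comp_apply]
    push_cast at *
    linarith

/-! ### The ratio `m / φ(m)` -/

lemma totient_eq_mul_exp (m : ℕ) :
    (m.totient : ℝ) = m * Real.exp (-∑ p ∈ m.primeFactors, primeWeight p) := by
  have h := Nat.totient_eq_mul_prod_factors m
  have h2 := congrArg (fun q : ℚ ↦ (q : ℝ)) h
  push_cast at h2
  rw [h2, ← sum_neg_distrib, Real.exp_sum]
  congr 1
  refine prod_congr rfl fun p hp ↦ ?_
  have hp := Nat.prime_of_mem_primeFactors hp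
  rw [primeWeight_of_prime hp, neg_neg, Real.exp_log (one_sub_one_div_pos hp), one_div]

lemma eq_totient_mul_exp (m : ℕ) :
    (m : ℝ) = m.totient * Real.exp (∑ p ∈ m.primeFactors, primeWeight p) := by
  rw [totient_eq_mul_exp, mul_assoc, ← Real.exp_add, neg_add_cancel, Real.exp_zero, mul_one]

/-- Passing to a multiple can only add prime factors, so `φ(n) / n` does not increase. -/
lemma totient_mul_le_totient_mul (m k : ℕ) : (m * k).totient ≤ m.totient * k := by
  rcases Nat.eq_zero_or_pos k with rfl | hk
  · simp
  rcases Nat.eq_zero_or_pos m with rfl | hm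
  · simp
  have h : ∑ p ∈ m.primeFactors, primeWeight p ≤ ∑ p ∈ (m * k).primeFactors, primeWeight p :=
    sum_le_sum_of_subset_of_nonneg
      (Nat.primeFactors_mono (dvd_mul_right m k) (Nat.mul_pos hm hk).ne')
      fun p _ _ ↦ primeWeight_nonneg p
  have h2 : ((m * k).totient : ℝ) ≤ m.totient * k := by
    rw [totient_eq_mul_exp, totient_eq_mul_exp m, mul_right_comm]
    push_cast
    gcongr
  exact_mod_cast h2

lemma sum_log_primeFactors_le {m : ℕ} (hm : m ≠ 0) :
    ∑ p ∈ m.primeFactors, Real.log p ≤ Real.log m := by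
  rw [← Real.log_prod fun p hp ↦ Nat.cast_ne_zero.2 (Nat.prime_of_mem_primeFactors hp).ne_zero]
  have h := Nat.le_of_dvd (Nat.pos_of_ne_zero hm) (Nat.prod_primeFactors_dvd m)
  refine Real.log_le_log (prod_pos fun p hp ↦ ?_) (by rw [← Nat.cast_prod]; exact Nat.cast_le.2 h)
  exact_mod_cast (Nat.prime_of_mem_primeFactors hp).pos

/-- With `y = log m`, a prime `p > y` has `w_p ≤ 1 / (p - 1) ≤ 2 log p / (y log y)`, using `y < p ≤
2 (p - 1)`. Summing `log p` over the prime factors gives at most `y`. -/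
lemma sum_primeFactors_primeWeight_le {m : ℕ} (hm : 1 < Real.log m) :
    ∑ p ∈ m.primeFactors, primeWeight p
      ≤ ∑ p ∈ ⌊Real.log m⌋₊.primesLE, primeWeight p + 2 / Real.log (Real.log m) := by
  set y := Real.log m
  have hm0 : m ≠ 0 := by
    rintro rfl
    simp [y] at hm
    linarith
  have hly : 0 < Real.log y := Real.log_pos hm
  rw [← sum_filter_add_sum_filter_not m.primeFactors (fun p ↦ p ≤ ⌊y⌋₊)]
  refine add_le_add (sum_le_sum_of_subset_of_nonneg (fun p hp ↦ ?_)
    fun p _ _ ↦ primeWeight_nonneg p) ?_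
  · rw [mem_filter] at hp
    exact Nat.mem_primesLE.2 ⟨hp.2, Nat.prime_of_mem_primeFactors hp.1⟩
  · calc ∑ p ∈ m.primeFactors with ¬ p ≤ ⌊y⌋₊, primeWeight p
        ≤ ∑ p ∈ m.primeFactors with ¬ p ≤ ⌊y⌋₊, 2 / (y * Real.log y) * Real.log p := by
          refine sum_le_sum fun p hp ↦ ?_
          rw [mem_filter, not_le] at hp
          have hp1 := Nat.prime_of_mem_primeFactors hp.1
          have hp2 : (2 : ℝ) ≤ p := by exact_mod_cast hp1.two_le
          have hyp : y < p := (Nat.floor_lt (by linarith)).1 hp.2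
          refine (primeWeight_le hp1).trans ?_
          rw [div_mul_eq_mul_div, div_le_div_iff₀ (by linarith) (by positivity)]
          have h1 : Real.log y ≤ Real.log p := Real.log_le_log (by linarith) hyp.le
          have h2 : y ≤ 2 * ((p : ℝ) - 1) := by linarith
          calc 1 * (y * Real.log y) = y * Real.log y := one_mul _
            _ ≤ 2 * ((p : ℝ) - 1) * Real.log p := mul_le_mul h2 h1 hly.le (by linarith)
            _ = 2 * Real.log p * ((p : ℝ) - 1) := by ring
      _ ≤ ∑ p ∈ m.primeFactors, 2 / (y * Real.log y) * Real.log p :=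
          sum_le_sum_of_subset_of_nonneg (filter_subset _ _) fun p _ _ ↦
            mul_nonneg (by positivity) (Real.log_natCast_nonneg p)
      _ ≤ 2 / (y * Real.log y) * y := by
          rw [← mul_sum]
          exact mul_le_mul_of_nonneg_left (sum_log_primeFactors_le hm0) (by positivity)
      _ = 2 / Real.log y := by field_simp

/-- The factor, tending to `exp γ`, in the upper bound `m / φ(m) ≤ mertensFactor (log m) * log log m`. -/
noncomputable def mertensFactor (y : ℝ) : ℝ :=
  Real.exp (∑ p ∈ ⌊y⌋₊.primesLE, primeWeight p - Real.log (Real.log y) + 2 / Real.log y)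

lemma tendsto_mertensFactor :
    Tendsto mertensFactor atTop (𝓝 (Real.exp Real.eulerMascheroniConstant)) := by
  have h := tendsto_sum_primeWeight_sub_log_log.add
    (Real.tendsto_log_atTop.const_div_atTop 2)
  rw [add_zero] at h
  exact (Real.continuous_exp.tendsto _).comp h

lemma le_totient_mul_mertensFactor {m : ℕ} (hm : 1 < Real.log m) :
    (m : ℝ) ≤ m.totient * (mertensFactor (Real.log m) * Real.log (Real.log m)) := by
  conv_lhs => rw [eq_totient_mul_exp m]
  refine mul_le_mul_of_nonneg_left ?_ (Nat.cast_nonneg _)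
  conv_rhs => rw [← Real.exp_log (Real.log_pos hm)]
  rw [mertensFactor, ← Real.exp_add, Real.exp_le_exp]
  have := sum_primeFactors_primeWeight_le hm
  linarith

lemma tendsto_log_natCast_atTop : Tendsto (fun m : ℕ ↦ Real.log m) atTop atTop :=
  Real.tendsto_log_atTop.comp tendsto_natCast_atTop_atTop

/-- A crude consequence of `m / φ(m) = O(log log m)`. It bounds the set of admissible `m` and lets
`log log m` be replaced by `log log x` up to `log 2`. -/
lemma eventually_le_totient_sq : ∀ᶠ m : ℕ in atTop, (m : ℝ) ≤ (m.totient : ℝ) ^ 2 := by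
  set c := Real.exp Real.eulerMascheroniConstant + 1
  have hc : 0 < c := by positivity
  have h1 : ∀ᶠ m : ℕ in atTop, mertensFactor (Real.log m) < c :=
    (tendsto_mertensFactor.comp tendsto_log_natCast_atTop).eventually_lt_const (lt_add_one _)
  have h2 : ∀ᶠ m : ℕ in atTop, ‖Real.log (m : ℝ)‖ ≤ c⁻¹ * ‖(m : ℝ) ^ (1 / 2 : ℝ)‖ :=
    tendsto_natCast_atTop_atTop.eventually
      ((isLittleO_log_rpow_atTop (by norm_num : (0 : ℝ) < 1 / 2)).bound (inv_pos.2 hc))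
  filter_upwards [h1, h2, tendsto_log_natCast_atTop.eventually_gt_atTop 1,
    eventually_ge_atTop 1] with m h1 h2 h3 h4
  have hm : (0 : ℝ) < m := by exact_mod_cast h4
  rw [← Real.sqrt_eq_rpow, Real.norm_of_nonneg (by linarith),
    Real.norm_of_nonneg (Real.sqrt_nonneg _), inv_mul_eq_div, le_div_iff₀ hc] at h2
  have h5 : Real.log (Real.log m) ≤ Real.log m :=
    (Real.log_le_sub_one_of_pos (by linarith)).trans (by linarith)
  have h6 : mertensFactor (Real.log m) * Real.log (Real.log m) ≤ √m := by
    have := mul_le_mul h1.le h5 (Real.log_pos h3).le hc.le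
    linarith
  have h7 := (le_totient_mul_mertensFactor h3).trans
    (mul_le_mul_of_nonneg_left h6 (Nat.cast_nonneg _))
  have h8 : √(m : ℝ) ≤ m.totient := by
    refine le_of_mul_le_mul_right ?_ (Real.sqrt_pos.2 hm)
    rwa [Real.mul_self_sqrt hm.le]
  calc (m : ℝ) = √m ^ 2 := (Real.sq_sqrt hm.le).symm
    _ ≤ _ := by gcongr

/-! ### Bounds for `m(x)` and conclusion -/

lemma bddAbove_totientPreimage (x : ℝ) : BddAbove (totientPreimage x) := by
  obtain ⟨N, hN⟩ := eventually_atTop.1 eventually_le_totient_sq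
  refine ⟨max N ⌊x ^ 2⌋₊, fun m hm ↦ ?_⟩
  rcases le_total m N with h | h
  · exact h.trans (le_max_left _ _)
  · refine (Nat.le_floor ((hN m h).trans ?_)).trans (le_max_right _ _)
    have := hm.2
    gcongr

lemma isGreatest_maxTotientPreimage {x : ℝ} (hx : 1 ≤ x) :
    IsGreatest (totientPreimage x) (maxTotientPreimage x) :=
  ⟨Nat.sSup_mem ⟨1, one_pos, by simpa using hx⟩ (bddAbove_totientPreimage x),
    fun _ hm ↦ le_csSup (bddAbove_totientPreimage x) hm⟩

lemma floor_le_maxTotientPreimage {x : ℝ} (hx : 1 ≤ x) : ⌊x⌋₊ ≤ maxTotientPreimage x := by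
  refine (isGreatest_maxTotientPreimage hx).2 ⟨Nat.floor_pos.2 hx, ?_⟩
  refine le_trans ?_ (Nat.floor_le (by linarith))
  exact_mod_cast Nat.totient_le _

lemma tendsto_maxTotientPreimage_atTop : Tendsto maxTotientPreimage atTop atTop := by
  refine tendsto_atTop_mono' _ ?_ tendsto_nat_floor_atTop
  filter_upwards [eventually_ge_atTop 1] with x hx
  exact floor_le_maxTotientPreimage hx

lemma eventually_maxTotientPreimage_le :
    ∀ᶠ x : ℝ in atTop, (maxTotientPreimage x : ℝ) ≤
      x * (mertensFactor (Real.log (maxTotientPreimage x)) *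
        (Real.log 2 + Real.log (Real.log x))) := by
  filter_upwards [eventually_gt_atTop 1,
    tendsto_maxTotientPreimage_atTop.eventually eventually_le_totient_sq,
    tendsto_maxTotientPreimage_atTop.eventually
      (tendsto_log_natCast_atTop.eventually_gt_atTop 1)] with x hx h1 h2
  have hφ := (isGreatest_maxTotientPreimage hx.le).1.2
  have hm := (isGreatest_maxTotientPreimage hx.le).1.1
  set m := maxTotientPreimage x
  have hm0 : (0 : ℝ) < m := by exact_mod_cast hm
  have h3 : Real.log m ≤ 2 * Real.log x := by
    have h4 : (m : ℝ) ≤ x ^ 2 := h1.trans (by gcongr)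
    have h5 := Real.log_le_log hm0 h4
    rw [Real.log_pow] at h5
    exact_mod_cast h5
  have h6 : Real.log (Real.log m) ≤ Real.log 2 + Real.log (Real.log x) := by
    rw [← Real.log_mul two_ne_zero (Real.log_pos hx).ne']
    exact Real.log_le_log (by linarith) h3
  have h0 : 0 ≤ mertensFactor (Real.log m) := Real.exp_nonneg _
  have h7 : 0 ≤ Real.log (Real.log m) := (Real.log_pos h2).le
  refine (le_totient_mul_mertensFactor h2).trans ?_
  gcongr

/-- The witness is `P * k`, with `P` the primorial and `k = ⌊x / φ(P)⌋`: its totient is at most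
`φ(P) * k ≤ x`. Rounding `k` loses at most `P ≤ x`, whence the term `- x`, negligible against `x log
log x`. -/
lemma eventually_le_maxTotientPreimage :
    ∀ᶠ x : ℝ in atTop,
      x * Real.exp (∑ p ∈ ⌊Real.log x / 4⌋₊.primesLE, primeWeight p) - x
        ≤ maxTotientPreimage x := by
  filter_upwards [eventually_ge_atTop 1] with x hx
  have hx0 : 0 < x := by linarith
  have hlx : 0 ≤ Real.log x := Real.log_nonneg hx
  set P := primorial ⌊Real.log x / 4⌋₊
  have hP : 0 < P := primorial_pos _
  have hP0 : (0 : ℝ) < P := by exact_mod_cast hP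
  have hφ : (0 : ℝ) < P.totient := by exact_mod_cast Nat.totient_pos.2 hP
  have hPx : (P : ℝ) ≤ x := by
    rw [← Real.log_le_log_iff hP0 hx0, ← Chebyshev.theta_eq_log_primorial]
    refine (Chebyshev.theta_le_log4_mul_x (by positivity)).trans ?_
    -- The divisor `4` in `(log x) / 4` absorbs the Chebyshev constant `log 4`.
    have : Real.log 4 ≤ 4 := (Real.log_le_sub_one_of_pos (by norm_num)).trans (by norm_num)
    nlinarith
  have hφP : (P.totient : ℝ) ≤ P := by exact_mod_cast P.totient_le
  set k := ⌊x / P.totient⌋₊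
  have hk : 1 ≤ k := Nat.le_floor (by
    rw [Nat.cast_one, one_le_div hφ]
    linarith)
  have hk1 : (k : ℝ) ≤ x / P.totient := Nat.floor_le (by positivity)
  have hk2 : x / P.totient < k + 1 := Nat.lt_floor_add_one _
  have hmem : P * k ∈ totientPreimage x := by
    refine ⟨Nat.mul_pos hP hk, ?_⟩
    rw [le_div_iff₀ hφ] at hk1
    have h : ((P * k).totient : ℝ) ≤ P.totient * k := by
      exact_mod_cast totient_mul_le_totient_mul P k
    linarith
  have hle : ((P * k : ℕ) : ℝ) ≤ maxTotientPreimage x := by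
    exact_mod_cast (isGreatest_maxTotientPreimage hx).2 hmem
  refine le_trans ?_ hle
  rw [← primeFactors_primorial]
  have e : x * Real.exp (∑ p ∈ P.primeFactors, primeWeight p) = P * (x / P.totient) := by
    conv_rhs => rw [eq_totient_mul_exp P]
    field_simp
  rw [e]
  push_cast
  nlinarith

lemma tendsto_log_log_atTop : Tendsto (fun x : ℝ ↦ Real.log (Real.log x)) atTop atTop :=
  Real.tendsto_log_atTop.comp Real.tendsto_log_atTop

/-- The cutoff `(log x) / 4` is harmless: dividing by `4` shifts `log log x` only by `log 4`. -/
lemma tendsto_exp_sum_primeWeight_div :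
    Tendsto (fun x : ℝ ↦ Real.exp (∑ p ∈ ⌊Real.log x / 4⌋₊.primesLE, primeWeight p)
      / Real.log (Real.log x)) atTop (𝓝 (Real.exp Real.eulerMascheroniConstant)) := by
  have hy : Tendsto (fun x : ℝ ↦ Real.log x / 4) atTop atTop :=
    Real.tendsto_log_atTop.atTop_div_const (by norm_num)
  have h1 := (Real.continuous_exp.tendsto _).comp (tendsto_sum_primeWeight_sub_log_log.comp hy)
  have h2 : Tendsto (fun x : ℝ ↦ 1 - Real.log 4 / Real.log (Real.log x)) atTop (𝓝 1) := by
    simpa using (tendsto_log_log_atTop.const_div_atTop (Real.log 4)).const_sub 1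
  have h3 := h1.mul h2
  rw [mul_one] at h3
  refine h3.congr' ?_
  filter_upwards [tendsto_log_log_atTop.eventually_gt_atTop 0, hy.eventually_gt_atTop 1]
    with x hL hy1
  have hl : Real.log (Real.log x / 4) = Real.log (Real.log x) - Real.log 4 :=
    Real.log_div (by intro h; rw [h] at hy1; norm_num at hy1) (by norm_num)
  have hpos : 0 < Real.log (Real.log x / 4) := Real.log_pos hy1
  simp only [Function.comp_apply]
  rw [Real.exp_sub, Real.exp_log hpos, hl]
  rw [hl] at hpos
  field_simp

theorem lemma2p1 :
    (∀ x : ℝ, 1 ≤ x → IsGreatest (totientPreimage x) (maxTotientPreimage x)) ∧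
      Asymptotics.IsEquivalent Filter.atTop
        (fun x : ℝ => (maxTotientPreimage x : ℝ))
        (fun x : ℝ => Real.exp Real.eulerMascheroniConstant * x * Real.log (Real.log x)) := by
  refine ⟨fun x hx ↦ isGreatest_maxTotientPreimage hx,
    Asymptotics.isEquivalent_of_tendsto_one ?_⟩
  set c := Real.exp Real.eulerMascheroniConstant
  have hc : 0 < c := Real.exp_pos _
  have hlow : Tendsto (fun x : ℝ ↦
      (Real.exp (∑ p ∈ ⌊Real.log x / 4⌋₊.primesLE, primeWeight p) / Real.log (Real.log x)
        - 1 / Real.log (Real.log x)) / c) atTop (𝓝 1) := by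
    have h := (tendsto_exp_sum_primeWeight_div.sub
      (tendsto_log_log_atTop.const_div_atTop 1)).div_const c
    rwa [sub_zero, div_self hc.ne'] at h
  have hup : Tendsto (fun x : ℝ ↦ mertensFactor (Real.log (maxTotientPreimage x)) / c
      * (Real.log 2 / Real.log (Real.log x) + 1)) atTop (𝓝 1) := by
    have h := ((tendsto_mertensFactor.comp (tendsto_log_natCast_atTop.comp
      tendsto_maxTotientPreimage_atTop)).div_const c).mul
      ((tendsto_log_log_atTop.const_div_atTop (Real.log 2)).add_const 1)
    rwa [zero_add, mul_one, div_self hc.ne'] at h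
  refine tendsto_of_tendsto_of_tendsto_of_le_of_le' hlow hup ?_ ?_
  · filter_upwards [eventually_le_maxTotientPreimage, eventually_gt_atTop 0,
      tendsto_log_log_atTop.eventually_gt_atTop 0] with x h hx hL
    rw [Pi.div_apply, le_div_iff₀ (by positivity)]
    refine le_trans (le_of_eq ?_) h
    field_simp
  · filter_upwards [eventually_maxTotientPreimage_le, eventually_gt_atTop 0,
      tendsto_log_log_atTop.eventually_gt_atTop 0] with x h hx hL
    rw [Pi.div_apply, div_le_iff₀ (by positivity)]
    refine h.trans (le_of_eq ?_)
    field_simp
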